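/- Let $n\ge 2$ and $N\ge 1$ be integers, and let $h:[-1,1]\to[0,\infty]$ be any function. For a finite set $C\subset\mathbb S^{n-1}\subset\mathbb R^n$ put $E(C;h)=\sum_{x,y\in C,\,x\ne y}h(\langle x,y\rangle)$ and let $\mathcal E(n,N;h)=\inf\{E(C;h): C\subset\mathbb S^{n-1},\ |C|=N\}\in[0,\infty]$. Let $P_i^{(n)}$ be the Gegenbauer polynomials, defined by $P_0^{(n)}=1$, $P_1^{(n)}=t$ and $(i+n-2)P_{i+1}^{(n)}(t)=(2i+n-2)\,t\,P_i^{(n)}(t)-iP_{i-1}^{(n)}(t)$ for $i\ge1$. Let $A_{n,h}$ be the set of functions $f:[-1,1]\to\mathbb R$ with $f\le h$ on $[-1,1]$ that have an expansion $f(t)=\sum_{j=0}^\infty f_jP_j^{(n)}(t)$, convergent for every $t\in[-1,1]$, with $f_j\ge0$ for all $j\ge1$. For a linear subspace $\Lambda\subset C([-1,1])$ of the space of real-valued continuous functions put $$\mathcal W(n,N,\Lambda;h)=\sup_{f\in\Lambda\cap A_{n,h}}N^2\bigl(f_0-f(1)/N\bigr).$$ A $1/N$-quadrature rule is a finite sequence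 of pairs $\{(\alpha_i,\rho_i)\}_{i=1}^k$ with $-1\le\alpha_1<\dots<\alpha_k<1$ and $\rho_i>0$ for all $i$; it is exact for $\Lambda$ if, with $\gamma_n=\Gamma(n/2)/\bigl(\sqrt\pi\,\Gamma((n-1)/2)\bigr)$, $$\gamma_n\int_{-1}^1 f(t)(1-t^2)^{(n-3)/2}\,dt=\frac{f(1)}N+\sum_{i=1}^k\rho_if(\alpha_i)\qquad\text{for all } f\in\Lambda.$$ **Theorem.** Let $\{(\alpha_i,\rho_i)\}_{i=1}^k$ be a $1/N$-quadrature rule that is exact for a linear subspace $\Lambda\subset C([-1,1])$. (a) If $f\in\Lambda\cap A_{n,h}$, then $\mathcal E(n,N;h)\ge N^2\sum_{i=1}^k\rho_if(\alpha_i)$. (b) $\mathcal W(n,N,\Lambda;h)\le N^2\sum_{i=1}^k\rho_ih(\alpha_i)$. (c) If there is some $f\in\Lambda\cap A_{n,h}$ with $f(\alpha_i)=h(\alpha_i)$ for $i=1,\dots,k$, then $\mathcal W(n,N,\Lambda;h)=N^2\sum_{i=1}^k\rho_ih(\alpha_i)$ and $\mathcal E(n,N;h)\ge N^2\sum_{i=1}^k\rho_ih(\alpha_i)$.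 -/

import Mathlib

open scoped ENNReal

noncomputable section

namespace SphericalCode

/-- The closed interval `[-1,1]`. -/
abbrev I : Type := Set.Icc (-1 : ℝ) 1

/-- The point `1` of `[-1,1]`. -/
def I.one : I := ⟨1, by norm_num, le_refl _⟩

/-- The unit sphere `S^{n-1}` of the Euclidean space `ℝⁿ`. -/
abbrev Sphere (n : ℕ) : Type := Metric.sphere (0 : EuclideanSpace ℝ (Fin n)) 1

/-- The inner product of two points of the unit sphere, as a point of `[-1,1]`. -/
def sphereInner {n : ℕ} (x y : Sphere n) : I :=
  ⟨inner ℝ (x : EuclideanSpace ℝ (Fin n)) (y : EuclideanSpace ℝ (Fin n)), by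
    have hx : ‖(x : EuclideanSpace ℝ (Fin n))‖ = 1 := by simp
    have hy : ‖(y : EuclideanSpace ℝ (Fin n))‖ = 1 := by simp
    have h := abs_real_inner_le_norm (x : EuclideanSpace ℝ (Fin n)) (y : EuclideanSpace ℝ (Fin n))
    rw [hx, hy, mul_one] at h
    exact abs_le.mp h⟩

open Classical in
/-- The `h`-energy `E(C;h)` of a spherical code: the sum over ordered pairs of distinct points. -/
def energy {n : ℕ} (C : Finset (Sphere n)) (h : I → ℝ≥0∞) : ℝ≥0∞ :=
  ∑ p ∈ C.offDiag, h (sphereInner p.1 p.2)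

/-- The minimal `h`-energy `ℰ(n,N;h)` of a spherical code of `N` points on `S^{n-1}`. -/
def minEnergy (n N : ℕ) (h : I → ℝ≥0∞) : ℝ≥0∞ :=
  ⨅ (C : Finset (Sphere n)) (_ : C.card = N), energy C h

/-- The Gegenbauer polynomials `P_i^{(n)}`, normalized by `P_i^{(n)}(1) = 1`, through
`(i+n-2) P_{i+1} = (2i+n-2) t P_i - i P_{i-1}` for `i ≥ 1` (meaningful for `n ≥ 2`). -/
def gegenbauer (n : ℕ) : ℕ → Polynomial ℝ
  | 0 => 1
  | 1 => Polynomial.X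
  | i + 2 =>
    Polynomial.C ((((i : ℝ) + 1) + (n : ℝ) - 2)⁻¹) *
      (Polynomial.C (2 * ((i : ℝ) + 1) + (n : ℝ) - 2) * Polynomial.X * gegenbauer n (i + 1)
        - Polynomial.C ((i : ℝ) + 1) * gegenbauer n i)

/-- `f(t) = ∑ c_k P_k^{(n)}(t)` for every `t ∈ [-1,1]`, with `c_k ≥ 0` for all `k ≥ 1`.
At `t = 1` this says `f(1) = ∑ c_k < ∞`. -/
def HasNonnegExpansion (n : ℕ) (f : I → ℝ) (c : ℕ → ℝ) : Prop :=
  (∀ t : I, HasSum (fun k => c k * (gegenbauer n k).eval (t : ℝ)) (f t)) ∧ ∀ k, 1 ≤ k → 0 ≤ c k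

/-- The class `A_{n,h}` of functions `f ≤ h` on `[-1,1]` with a Gegenbauer expansion whose
coefficients of positive index are nonnegative. -/
def admissible (n : ℕ) (h : I → ℝ≥0∞) : Set (I → ℝ) :=
  {f | (∀ t : I, ((f t : ℝ) : EReal) ≤ ((h t : ℝ≥0∞) : EReal)) ∧ ∃ c, HasNonnegExpansion n f c}

/-- The linear programming value `𝒲(n,N,Λ;h)`: the supremum, in the extended reals, of
`N² (f₀ - f(1)/N)` over `f ∈ Λ ∩ A_{n,h}`, where `f₀` is the coefficient of index `0` in the
Gegenbauer expansion of `f`. -/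
def lpValue (n N : ℕ) (Λ : Submodule ℝ C(I, ℝ)) (h : I → ℝ≥0∞) : EReal :=
  sSup {w : EReal | ∃ f : C(I, ℝ), f ∈ Λ ∧ (f : I → ℝ) ∈ admissible n h ∧
    ∃ c : ℕ → ℝ, HasNonnegExpansion n f c ∧
      w = (((N : ℝ) ^ 2 * (c 0 - f I.one / N) : ℝ) : EReal)}

/-- The normalizing constant `γ_n = Γ(n/2) / (√π Γ((n-1)/2))`. -/
def gammaConst (n : ℕ) : ℝ :=
  Real.Gamma ((n : ℝ) / 2) / (Real.sqrt Real.pi * Real.Gamma (((n : ℝ) - 1) / 2))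

/-- `γ_n ∫_{-1}^1 f(t) (1-t²)^{(n-3)/2} dt`; only the values of `f` on `[-1,1]` matter, the
constant extension `Set.IccExtend` just makes `f` a function of a real variable. -/
def weightedMean (n : ℕ) (f : C(I, ℝ)) : ℝ :=
  gammaConst n * ∫ t in (-1 : ℝ)..1,
    Set.IccExtend (by norm_num : (-1 : ℝ) ≤ 1) f t * (1 - t ^ 2) ^ (((n : ℝ) - 3) / 2)

/-- Nodes `-1 ≤ α_1 < ⋯ < α_k < 1` and weights `ρ_i > 0`. -/
structure IsQuadratureRule {k : ℕ} (α : Fin k → I) (ρ : Fin k → ℝ) : Prop where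
  strictMono : StrictMono α
  lt_one : ∀ i, (α i : ℝ) < 1
  weight_pos : ∀ i, 0 < ρ i

/-- The `1/N`-quadrature rule `(α, ρ)` on `[-1,1]` is exact for `Λ`. -/
def IsExactFor (n N : ℕ) {k : ℕ} (α : Fin k → I) (ρ : Fin k → ℝ)
    (Λ : Submodule ℝ C(I, ℝ)) : Prop :=
  ∀ f ∈ Λ, weightedMean n f = f I.one / N + ∑ i, ρ i * f (α i)

/-- `N² ∑ ρ_i h(α_i)`, as an element of `[0,∞]` (for positive weights). -/
def potentialSum (N : ℕ) {k : ℕ} (α : Fin k → I) (ρ : Fin k → ℝ) (h : I → ℝ≥0∞) : ℝ≥0∞ :=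
  (N : ℝ≥0∞) ^ 2 * ∑ i, ENNReal.ofReal (ρ i) * h (α i)

end SphericalCode

end

/-!
For an admissible `f` with expansion coefficients `c`, the value `N² (c₀ - f(1)/N)` plays two roles.

*It bounds the energy.* The kernel `(x, y) ↦ P_k(⟨x,y⟩)` on the sphere is positive semidefinite
(Schoenberg), so the double sum of `f(⟨x,y⟩)` over a code of `N` points is at least its contribution
`N² c₀` from `k = 0`; removing the `N` diagonal terms `f(1)` and using `f ≤ h` gives
`N² (c₀ - f(1)/N) ≤ E(C;h)`, which is `le_minEnergy`.

*It is a quadrature sum.* The `P_k` with `k ≥ 1` have mean zero for the weight `(1-t²)^((n-3)/2)`,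
so `c₀` is the weighted mean of `f` (`weightedMean_eq_coeff_zero`), and exactness of the rule on `Λ`
turns `c₀ - f(1)/N` into `∑ ρ_i f(α_i)` (`coeff_zero_sub_eq_sum`). All three claims follow by
comparing `f` with `h` at the nodes.

Positive semidefiniteness (`sum_mul_gegenbauer_nonneg`) is proved algebraically. For a unit vector
`y`, homogenizing the Gegenbauer recurrence gives a polynomial `zonal y k` that is homogeneous of
degree `k`, is harmonic, and takes the value `P_k(⟨x,y⟩)` at unit vectors `x`. In the Fischer inner
product multiplication by a linear form is adjoint to a directional derivative and multiplication by
`|x|²` is adjoint to the Laplacian, so by induction the pairing of `zonal x k` with any harmonic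
form `q` of degree `k` is a positive multiple of `q(x)`. Hence `P_k(⟨x,y⟩)` is, up to a positive factor,
a Gram kernel. Applied to two points this also gives `|P_k| ≤ 1` on `[-1,1]`, which makes the
expansion of `f` dominated and permits termwise integration. The vanishing of the means comes
from the Gegenbauer differential equation (`gegenbauer_ode`), which exhibits `P_k · weight` as an
exact derivative of a function vanishing at `±1`.
-/

noncomputable section

namespace SphericalCode

/-! ### The Fischer inner product on polynomials -/

section Fischer

open MvPolynomial

variable {n : ℕ}

/-- The Fischer inner product `⟨p, q⟩ = ∑_a a! p_a q_a` on real polynomials, where `a!` is the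
product of the factorials of the exponents; equivalently `p(∂) q` at the origin. -/
def fischer : MvPolynomial (Fin n) ℝ →ₗ[ℝ] MvPolynomial (Fin n) ℝ →ₗ[ℝ] ℝ :=
  (basisMonomials (Fin n) ℝ).constr ℝ fun a => ((∏ i, (a i).factorial : ℕ) : ℝ) • lcoeff ℝ a

lemma fischer_monomial (a : Fin n →₀ ℕ) (q : MvPolynomial (Fin n) ℝ) :
    fischer (monomial a 1) q = ((∏ i, (a i).factorial : ℕ) : ℝ) * coeff a q := by
  have h : fischer (basisMonomials (Fin n) ℝ a) = ((∏ i, (a i).factorial : ℕ) : ℝ) • lcoeff ℝ a :=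
    Module.Basis.constr_basis _ _ _ _
  rw [coe_basisMonomials] at h
  rw [h]
  simp [lcoeff]

lemma fischer_self_nonneg (p : MvPolynomial (Fin n) ℝ) : 0 ≤ fischer p p := by
  have h : fischer p = ∑ a ∈ p.support, coeff a p • fischer (monomial a 1) := by
    conv_lhs => rw [p.as_sum]
    rw [map_sum]
    refine Finset.sum_congr rfl fun a _ => ?_
    rw [← map_smul, smul_monomial, smul_eq_mul, mul_one]
  rw [h, LinearMap.sum_apply]
  refine Finset.sum_nonneg fun a _ => ?_
  rw [LinearMap.smul_apply, fischer_monomial, smul_eq_mul, mul_left_comm]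
  exact mul_nonneg (Nat.cast_nonneg _) (mul_self_nonneg _)

/-- Multiplication by a variable is adjoint to the partial derivative in that variable. -/
lemma fischer_X_mul (i : Fin n) (p q : MvPolynomial (Fin n) ℝ) :
    fischer (X i * p) q = fischer p (pderiv i q) := by
  induction p using MvPolynomial.induction_on' with
  | add p₁ p₂ h₁ h₂ => simp only [mul_add, map_add, LinearMap.add_apply, h₁, h₂]
  | monomial a r =>
    rw [← mul_one r, ← smul_eq_mul (a := r), ← smul_monomial, mul_smul_comm, map_smul, map_smul,
      LinearMap.smul_apply, LinearMap.smul_apply, X, monomial_mul, one_mul, fischer_monomial,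
      fischer_monomial, coeff_pderiv]
    have h : ∏ j, ((Finsupp.single i 1 + a : Fin n →₀ ℕ) j).factorial =
        (a i + 1) * ∏ j, (a j).factorial := by
      rw [← Finset.mul_prod_erase _ _ (Finset.mem_univ i),
        ← Finset.mul_prod_erase (a := i) (f := fun j => (a j).factorial) _ (Finset.mem_univ i),
        ← mul_assoc]
      congr 1
      · simp [add_comm 1, Nat.factorial_succ]
      · refine Finset.prod_congr rfl fun j hj => ?_
        simp [Finsupp.single_eq_of_ne (Finset.ne_of_mem_erase hj)]
    rw [h, add_comm (Finsupp.single i 1)]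
    push_cast
    ring

/-! ### Linear forms, the squared norm and their adjoint operators -/

/-- The linear form `x ↦ ⟨y, x⟩` as a polynomial. -/
def linForm (y : Fin n → ℝ) : MvPolynomial (Fin n) ℝ := ∑ i, C (y i) * X i

/-- The squared Euclidean norm `∑ x_i²` as a polynomial. -/
def normSq (n : ℕ) : MvPolynomial (Fin n) ℝ := ∑ i, X i * X i

/-- The derivative of polynomials in the constant direction `y`. -/
def dirDeriv (y : Fin n → ℝ) :
    Derivation ℝ (MvPolynomial (Fin n) ℝ) (MvPolynomial (Fin n) ℝ) :=
  ∑ i, y i • pderiv i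

/-- The Laplace operator `∑ ∂_i²` on polynomials. -/
def laplacian (n : ℕ) : MvPolynomial (Fin n) ℝ →ₗ[ℝ] MvPolynomial (Fin n) ℝ :=
  ∑ i, (pderiv i).toLinearMap ∘ₗ (pderiv i).toLinearMap

lemma dirDeriv_apply (y : Fin n → ℝ) (p : MvPolynomial (Fin n) ℝ) :
    dirDeriv y p = ∑ i, C (y i) * pderiv i p := by
  rw [dirDeriv, ← Derivation.coeFnAddMonoidHom_apply, map_sum, Finset.sum_apply]
  simp [smul_eq_C_mul]

lemma laplacian_apply (p : MvPolynomial (Fin n) ℝ) :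
    laplacian n p = ∑ i, pderiv i (pderiv i p) := by
  simp [laplacian]

lemma pderiv_comm (i j : Fin n) (p : MvPolynomial (Fin n) ℝ) :
    pderiv i (pderiv j p) = pderiv j (pderiv i p) := by
  have h : ⁅pderiv (R := ℝ) i, pderiv j⁆ =
      (0 : Derivation ℝ (MvPolynomial (Fin n) ℝ) (MvPolynomial (Fin n) ℝ)) := by
    refine MvPolynomial.derivation_ext fun k => ?_
    classical
    rw [Derivation.commutator_apply, pderiv_X, pderiv_X, Pi.single_apply, Pi.single_apply]
    split_ifs <;> simp
  have := DFunLike.congr_fun h p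
  rw [Derivation.commutator_apply] at this
  exact sub_eq_zero.mp this

lemma laplacian_dirDeriv (y : Fin n → ℝ) (p : MvPolynomial (Fin n) ℝ) :
    laplacian n (dirDeriv y p) = dirDeriv y (laplacian n p) := by
  simp only [laplacian_apply, dirDeriv_apply, map_sum, pderiv_C_mul]
  rw [Finset.sum_comm]
  refine Finset.sum_congr rfl fun i _ => Finset.sum_congr rfl fun j _ => ?_
  rw [pderiv_comm i j p, pderiv_comm i j]

lemma fischer_linForm_mul (y : Fin n → ℝ) (p q : MvPolynomial (Fin n) ℝ) :
    fischer (linForm y * p) q = fischer p (dirDeriv y q) := by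
  simp only [linForm, Finset.sum_mul, map_sum, LinearMap.sum_apply, dirDeriv_apply,
    ← smul_eq_C_mul, smul_mul_assoc, map_smul, LinearMap.smul_apply, fischer_X_mul]

lemma fischer_normSq_mul (p q : MvPolynomial (Fin n) ℝ) :
    fischer (normSq n * p) q = fischer p (laplacian n q) := by
  simp only [normSq, Finset.sum_mul, map_sum, LinearMap.sum_apply, laplacian_apply, mul_assoc,
    fischer_X_mul]

lemma pderiv_linForm (y : Fin n → ℝ) (i : Fin n) : pderiv i (linForm y) = C (y i) := by
  classical
  simp [linForm, pderiv_X, Pi.single_apply]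

lemma pderiv_normSq (i : Fin n) : pderiv i (normSq n) = 2 * X i := by
  classical
  simp [normSq, pderiv_X, Pi.single_apply, Finset.sum_add_distrib, two_mul]

lemma dirDeriv_linForm (y : Fin n → ℝ) : dirDeriv y (linForm y) = C (∑ i, y i ^ 2) := by
  simp [dirDeriv_apply, pderiv_linForm, sq]

lemma dirDeriv_normSq (y : Fin n → ℝ) : dirDeriv y (normSq n) = 2 * linForm y := by
  simp only [dirDeriv_apply, pderiv_normSq, linForm, Finset.mul_sum]
  exact Finset.sum_congr rfl fun i _ => by ring

lemma laplacian_linForm_mul (y : Fin n → ℝ) (p : MvPolynomial (Fin n) ℝ) :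
    laplacian n (linForm y * p) = 2 * dirDeriv y p + linForm y * laplacian n p := by
  simp only [laplacian_apply, dirDeriv_apply, pderiv_mul, map_add, pderiv_linForm, pderiv_C,
    zero_mul, zero_add, Finset.mul_sum, ← Finset.sum_add_distrib]
  exact Finset.sum_congr rfl fun i _ => by ring

lemma laplacian_normSq_mul {k : ℕ} {p : MvPolynomial (Fin n) ℝ} (hp : p.IsHomogeneous k) :
    laplacian n (normSq n * p) = C (2 * (n : ℝ) + 4 * k) * p + normSq n * laplacian n p := by
  have h := hp.sum_X_mul_pderiv
  have h2 : ∀ i, pderiv i (2 : MvPolynomial (Fin n) ℝ) = 0 := fun i => by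
    rw [← map_ofNat C 2, pderiv_C]
  have e : ∀ i, pderiv i (pderiv i (normSq n * p)) =
      2 * p + 4 * (X i * pderiv i p) + normSq n * pderiv i (pderiv i p) := fun i => by
    simp only [pderiv_mul, map_add, pderiv_normSq, pderiv_X_self, h2]
    ring
  simp only [laplacian_apply, e, Finset.sum_add_distrib, ← Finset.mul_sum, h]
  simp only [Finset.sum_const, Finset.card_univ, Fintype.card_fin, nsmul_eq_mul, map_add, map_mul,
    map_ofNat, map_natCast]
  ring

lemma isHomogeneous_linForm (y : Fin n → ℝ) : (linForm y).IsHomogeneous 1 :=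
  IsHomogeneous.sum _ _ _ fun i _ => by
    simpa using (isHomogeneous_C (Fin n) (y i)).mul (isHomogeneous_X ℝ i)

lemma isHomogeneous_normSq : (normSq n).IsHomogeneous 2 :=
  IsHomogeneous.sum _ _ _ fun i _ => (isHomogeneous_X ℝ i).mul (isHomogeneous_X ℝ i)

lemma isHomogeneous_dirDeriv (y : Fin n → ℝ) {k : ℕ} {p : MvPolynomial (Fin n) ℝ}
    (hp : p.IsHomogeneous (k + 1)) : (dirDeriv y p).IsHomogeneous k := by
  rw [dirDeriv_apply]
  refine IsHomogeneous.sum _ _ _ fun i _ => ?_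
  simpa using (isHomogeneous_C (Fin n) (y i)).mul hp.pderiv

/-- Euler's identity, read at a point: a form of degree `k` has derivative `k p(x)` at `x` in the
direction `x`. -/
lemma eval_dirDeriv (x : Fin n → ℝ) {k : ℕ} {p : MvPolynomial (Fin n) ℝ}
    (hp : p.IsHomogeneous k) : eval x (dirDeriv x p) = k * eval x p := by
  have h := congrArg (eval x) hp.sum_X_mul_pderiv
  simpa [dirDeriv_apply] using h

/-! ### Zonal harmonics -/

/-- The zonal polynomial with pole `y` of degree `k`: the homogenization
`|x|^k P_k^{(n)}(⟨x,y⟩/|x|)` in `x` of the Gegenbauer polynomial, defined by the homogenized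
recurrence. It is harmonic when `y` is a unit vector. -/
def zonal (y : Fin n → ℝ) : ℕ → MvPolynomial (Fin n) ℝ
  | 0 => 1
  | 1 => linForm y
  | i + 2 =>
    C ((((i : ℝ) + 1) + (n : ℝ) - 2)⁻¹) *
      (C (2 * ((i : ℝ) + 1) + (n : ℝ) - 2) * (linForm y * zonal y (i + 1))
        - C ((i : ℝ) + 1) * (normSq n * zonal y i))

lemma isHomogeneous_zonal (y : Fin n → ℝ) : ∀ k, (zonal y k).IsHomogeneous k
  | 0 => isHomogeneous_one _ _
  | 1 => isHomogeneous_linForm y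
  | k + 2 => by
    have h₁ := (isHomogeneous_C (Fin n) (2 * ((k : ℝ) + 1) + (n : ℝ) - 2)).mul
      ((isHomogeneous_linForm y).mul (isHomogeneous_zonal y (k + 1)))
    have h₂ := (isHomogeneous_C (Fin n) ((k : ℝ) + 1)).mul
      ((isHomogeneous_normSq (n := n)).mul (isHomogeneous_zonal y k))
    rw [show 0 + (1 + (k + 1)) = k + 2 by ring] at h₁
    rw [show 0 + (2 + k) = k + 2 by ring] at h₂
    have h := (isHomogeneous_C (Fin n) ((((k : ℝ) + 1) + (n : ℝ) - 2)⁻¹)).mul (h₁.sub h₂)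
    rw [zero_add] at h
    rw [zonal]
    exact h

lemma recurrence_denom_pos (hn : 2 ≤ n) (k : ℕ) : (0 : ℝ) < (k : ℝ) + 1 + n - 2 := by
  have : (2 : ℝ) ≤ n := by exact_mod_cast hn
  have : (0 : ℝ) ≤ k := Nat.cast_nonneg k
  linarith

lemma C_mul_zonal_add_two (hn : 2 ≤ n) (y : Fin n → ℝ) (k : ℕ) :
    C ((k : ℝ) + 1 + n - 2) * zonal y (k + 2) =
      C (2 * ((k : ℝ) + 1) + (n : ℝ) - 2) * (linForm y * zonal y (k + 1))
        - C ((k : ℝ) + 1) * (normSq n * zonal y k) := by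
  rw [zonal, ← mul_assoc, ← C_mul, mul_inv_cancel₀ (recurrence_denom_pos hn k).ne', C_1, one_mul]

lemma C_mul_cancel {c : ℝ} (hc : c ≠ 0) {p q : MvPolynomial (Fin n) ℝ}
    (h : C c * p = C c * q) : p = q :=
  mul_left_cancel₀ (by simpa using hc) h

lemma dirDeriv_C_mul (y : Fin n → ℝ) (c : ℝ) (p : MvPolynomial (Fin n) ℝ) :
    dirDeriv y (C c * p) = C c * dirDeriv y p := by
  rw [← smul_eq_C_mul, Derivation.map_smul, smul_eq_C_mul]

lemma laplacian_C_mul (c : ℝ) (p : MvPolynomial (Fin n) ℝ) :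
    laplacian n (C c * p) = C c * laplacian n p := by
  rw [← smul_eq_C_mul, map_smul, smul_eq_C_mul]

/-- Differentiating a zonal harmonic along its own pole lowers the degree by one. This is what makes
the two terms of the recurrence cancel under the Laplacian. -/
lemma dirDeriv_zonal_succ (hn : 2 ≤ n) {y : Fin n → ℝ} (hy : ∑ i, y i ^ 2 = 1) :
    ∀ k : ℕ, dirDeriv y (zonal y (k + 1)) = C ((k : ℝ) + 1) * zonal y k
  | 0 => by simp [zonal, dirDeriv_linForm, hy]
  | 1 => by
    apply C_mul_cancel (recurrence_denom_pos hn 0).ne'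
    rw [← dirDeriv_C_mul, C_mul_zonal_add_two hn]
    rw [Derivation.map_sub, dirDeriv_C_mul, dirDeriv_C_mul]
    simp only [zonal, mul_one, Derivation.leibniz, smul_eq_mul, dirDeriv_linForm, dirDeriv_normSq,
      hy]
    simp only [map_add, map_mul, map_sub, map_one, map_ofNat, map_natCast]
    push_cast
    ring
  | k + 2 => by
    apply C_mul_cancel (recurrence_denom_pos hn (k + 1)).ne'
    rw [← dirDeriv_C_mul, C_mul_zonal_add_two hn]
    rw [Derivation.map_sub, dirDeriv_C_mul, dirDeriv_C_mul]
    simp only [Derivation.leibniz, smul_eq_mul,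
      dirDeriv_linForm, dirDeriv_normSq, hy, dirDeriv_zonal_succ hn hy (k + 1),
      dirDeriv_zonal_succ hn hy k]
    have h := C_mul_zonal_add_two hn y k
    simp only [map_add, map_mul, map_sub, map_one, map_ofNat, map_natCast] at h ⊢
    push_cast at h ⊢
    linear_combination -((k : MvPolynomial (Fin n) ℝ) + 2) * h

lemma laplacian_zonal (hn : 2 ≤ n) {y : Fin n → ℝ} (hy : ∑ i, y i ^ 2 = 1) :
    ∀ k : ℕ, laplacian n (zonal y k) = 0
  | 0 => by simp [zonal, laplacian_apply]
  | 1 => by simp [zonal, laplacian_apply, pderiv_linForm]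
  | k + 2 => by
    apply C_mul_cancel (recurrence_denom_pos hn k).ne'
    rw [← laplacian_C_mul, C_mul_zonal_add_two hn]
    rw [LinearMap.map_sub, laplacian_C_mul, laplacian_C_mul]
    simp only [laplacian_linForm_mul,
      laplacian_normSq_mul (isHomogeneous_zonal y k), laplacian_zonal hn hy (k + 1),
      laplacian_zonal hn hy k, dirDeriv_zonal_succ hn hy]
    simp only [map_add, map_mul, map_sub, map_one, map_ofNat, map_natCast]
    ring

/-- Reproducing property: the Fischer pairing of `zonal x k` with a harmonic form `q` of degree `k`
is a positive multiple of `q(x)`, with a factor depending only on `k` and `n`. By adjointness the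
recurrence for `zonal x (k + 2)` becomes a pairing of `zonal x (k + 1)` with the derivative of `q`
along `x`; the other term meets the Laplacian of `q` and vanishes. -/
lemma exists_fischer_zonal (hn : 2 ≤ n) : ∀ k : ℕ, ∃ b : ℝ, 0 < b ∧
    ∀ (x : Fin n → ℝ) (q : MvPolynomial (Fin n) ℝ), q.IsHomogeneous k → laplacian n q = 0 →
      fischer (zonal x k) q = b * eval x q
  | 0 => ⟨1, one_pos, fun x q hq _ => by
      rw [← totalDegree_zero_iff_isHomogeneous, totalDegree_eq_zero_iff_eq_C] at hq
      rw [hq, zonal, ← C_1, C_apply, fischer_monomial]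
      simp⟩
  | 1 => by
    obtain ⟨b, hb, h⟩ := exists_fischer_zonal hn 0
    refine ⟨b, hb, fun x q hq hΔ => ?_⟩
    have h' := h x (dirDeriv x q) (isHomogeneous_dirDeriv x hq)
      (by rw [laplacian_dirDeriv, hΔ, map_zero])
    rw [eval_dirDeriv x hq, Nat.cast_one, one_mul, ← fischer_linForm_mul] at h'
    simpa [zonal] using h'
  | k + 2 => by
    obtain ⟨b, hb, h⟩ := exists_fischer_zonal hn (k + 1)
    have hd := recurrence_denom_pos hn k
    have hk : (0 : ℝ) ≤ k := Nat.cast_nonneg k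
    refine ⟨((k : ℝ) + 1 + n - 2)⁻¹ * (2 * ((k : ℝ) + 1) + n - 2) * (b * (k + 2)),
      mul_pos (mul_pos (inv_pos.mpr hd) (by linarith)) (by positivity), fun x q hq hΔ => ?_⟩
    have h' := h x (dirDeriv x q) (isHomogeneous_dirDeriv x hq)
      (by rw [laplacian_dirDeriv, hΔ, map_zero])
    rw [eval_dirDeriv x hq] at h'
    rw [zonal]
    simp only [← smul_eq_C_mul, LinearMap.map_smul, LinearMap.map_sub, LinearMap.smul_apply,
      LinearMap.sub_apply, fischer_linForm_mul, fischer_normSq_mul, hΔ, map_zero, h', smul_eq_mul]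
    push_cast
    ring

lemma eval_zonal {x y : Fin n → ℝ} (hx : ∑ i, x i ^ 2 = 1) :
    ∀ k : ℕ, eval x (zonal y k) = (gegenbauer n k).eval (∑ i, y i * x i)
  | 0 => by simp [zonal, gegenbauer]
  | 1 => by simp [zonal, gegenbauer, linForm]
  | k + 2 => by
    simp [zonal, gegenbauer, linForm, normSq, eval_zonal hx (k + 1), eval_zonal hx k, ← sq, hx,
      mul_assoc]

end Fischer

/-- Schoenberg's theorem: the kernel `P_k^{(n)}(⟨x,y⟩)` on the unit sphere is positive semidefinite,
being proportional to the Gram kernel of the zonal harmonics in the Fischer inner product. -/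
theorem sum_mul_gegenbauer_nonneg {n : ℕ} (hn : 2 ≤ n) (k : ℕ) {ι : Type*} (s : Finset ι)
    (x : ι → Sphere n) (a : ι → ℝ) :
    0 ≤ ∑ i ∈ s, ∑ j ∈ s, a i * a j * (gegenbauer n k).eval (sphereInner (x i) (x j) : ℝ) := by
  obtain ⟨b, hb, h⟩ := exists_fischer_zonal hn k
  have hs : ∀ i, ∑ l, (x i : EuclideanSpace ℝ (Fin n)) l ^ 2 = 1 := fun i => by
    rw [← EuclideanSpace.real_norm_sq_eq]; simp
  let Z : ι → MvPolynomial (Fin n) ℝ := fun i => zonal (fun l => (x i).1 l) k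
  have e : ∀ i j, fischer (Z i) (Z j) =
      b * (gegenbauer n k).eval (sphereInner (x i) (x j) : ℝ) := by
    intro i j
    rw [h _ _ (isHomogeneous_zonal _ k) (laplacian_zonal hn (hs j) k), eval_zonal (hs i)]
    simp [sphereInner, PiLp.inner_apply]
  have h₀ := fischer_self_nonneg (∑ i ∈ s, a i • Z i)
  simp only [map_sum, map_smul, LinearMap.sum_apply, LinearMap.smul_apply, e, smul_eq_mul] at h₀
  refine nonneg_of_mul_nonneg_right (h₀.trans_eq ?_) hb
  simp only [Finset.mul_sum]
  rw [Finset.sum_comm]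
  exact Finset.sum_congr rfl fun i _ => Finset.sum_congr rfl fun j _ => by ring

/-! ### The Gegenbauer differential equation -/

section Orthogonality

open Polynomial MeasureTheory

variable {n : ℕ}

lemma natCast_add_sub_eq_C (n k : ℕ) : (k + 1 + n - 2 : ℝ[X]) = C ((k : ℝ) + 1 + n - 2) := by
  simp only [map_add, map_sub, map_natCast, map_one, map_ofNat]

lemma natCast_add_sub_ne_zero (hn : 2 ≤ n) (k : ℕ) : (k + 1 + n - 2 : ℝ[X]) ≠ 0 := by
  rw [natCast_add_sub_eq_C, Ne, C_eq_zero]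
  exact (recurrence_denom_pos hn k).ne'

lemma gegenbauer_recurrence (hn : 2 ≤ n) (k : ℕ) :
    ((k : ℝ[X]) + 1 + (n : ℝ[X]) - 2) * gegenbauer n (k + 2) =
      (2 * ((k : ℝ[X]) + 1) + (n : ℝ[X]) - 2) * X * gegenbauer n (k + 1)
        - ((k : ℝ[X]) + 1) * gegenbauer n k := by
  rw [gegenbauer, natCast_add_sub_eq_C, ← mul_assoc, ← C_mul,
    mul_inv_cancel₀ (recurrence_denom_pos hn k).ne', C_1, one_mul]
  simp only [map_add, map_sub, map_mul, map_natCast, map_one, map_ofNat]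

lemma one_sub_sq_mul_derivative_gegenbauer (hn : 2 ≤ n) : ∀ k : ℕ,
    (1 - X ^ 2) * derivative (gegenbauer n k) =
      ((k : ℝ[X]) + (n : ℝ[X]) - 2) * (X * gegenbauer n k - gegenbauer n (k + 1))
  | 0 => by simp [gegenbauer]
  | 1 => by
    have h := gegenbauer_recurrence hn 0
    have h₀ : gegenbauer n 0 = 1 := rfl
    have h₁ : gegenbauer n 1 = X := rfl
    simp only [zero_add, h₀, h₁, derivative_X, Nat.cast_zero, Nat.cast_one] at h ⊢
    linear_combination h
  | k + 2 => by
    have h := gegenbauer_recurrence hn k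
    have h' := gegenbauer_recurrence hn (k + 1)
    have hd := congrArg derivative h
    simp only [derivative_mul, derivative_sub, derivative_add, derivative_natCast, derivative_X,
      derivative_one, derivative_ofNat] at hd
    have i₀ := one_sub_sq_mul_derivative_gegenbauer hn k
    have i₁ := one_sub_sq_mul_derivative_gegenbauer hn (k + 1)
    refine mul_left_cancel₀ (natCast_add_sub_ne_zero hn k) ?_
    push_cast at h' i₁ ⊢
    linear_combination (1 - X ^ 2) * hd + (2 * ((k : ℝ[X]) + 1) + (n : ℝ[X]) - 2) * X * i₁
      - ((k : ℝ[X]) + 1) * i₀ + ((k : ℝ[X]) + 1 + (n : ℝ[X]) - 2) * h'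
      - ((k : ℝ[X]) + n - 2) * X * h

/-- The Gegenbauer differential equation. -/
lemma gegenbauer_ode (hn : 2 ≤ n) (k : ℕ) :
    (1 - X ^ 2) * derivative (derivative (gegenbauer n (k + 1)))
      - ((n : ℝ[X]) - 1) * X * derivative (gegenbauer n (k + 1)) =
      - (((k : ℝ[X]) + 1) * ((k : ℝ[X]) + (n : ℝ[X]) - 1)) * gegenbauer n (k + 1) := by
  have h₀ := one_sub_sq_mul_derivative_gegenbauer hn k
  have h₁ : (1 - X ^ 2) * derivative (gegenbauer n (k + 1)) =
      ((k : ℝ[X]) + 1) * (gegenbauer n k - X * gegenbauer n (k + 1)) := by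
    have h := one_sub_sq_mul_derivative_gegenbauer hn (k + 1)
    push_cast at h
    linear_combination h - gegenbauer_recurrence hn k
  have hd := congrArg derivative h₁
  simp only [derivative_mul, derivative_sub, derivative_add, derivative_natCast, derivative_X,
    derivative_one, derivative_X_pow] at hd
  -- The equation is checked after multiplication by `1 - X²`, where every derivative of `P_k` and
  -- `P_{k+1}` can be eliminated through the first-order relations.
  have hX : (1 - X ^ 2 : ℝ[X]) ≠ 0 := fun h => by simpa using congrArg (eval 0) h
  refine mul_left_cancel₀ hX ?_
  simp only [map_natCast] at hd
  push_cast at hd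
  linear_combination (1 - X ^ 2) * hd + ((k : ℝ[X]) + 1) * h₀
    + (2 - ((k : ℝ[X]) + 1) - ((n : ℝ[X]) - 1)) * X * h₁

/-! ### The weight function and vanishing means -/

/-- The Beta integral `B(s,s)` transported to `[-1,1]` and simplified by Legendre duplication. -/
lemma integral_one_sub_sq_rpow {s : ℝ} (hs : 0 < s) :
    ∫ t in (-1 : ℝ)..1, (1 - t ^ 2) ^ (s - 1) =
      Real.sqrt Real.pi * Real.Gamma s / Real.Gamma (s + 1 / 2) := by
  have hbeta : ∫ x in (0 : ℝ)..1, x ^ (s - 1) * (1 - x) ^ (s - 1) =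
      Real.Gamma s * Real.Gamma s / Real.Gamma (s + s) := by
    have h := Complex.betaIntegral_eq_Gamma_mul_div s s (by simpa) (by simpa)
    have h' : Complex.betaIntegral s s =
        ((∫ x in (0 : ℝ)..1, x ^ (s - 1) * (1 - x) ^ (s - 1) : ℝ) : ℂ) := by
      rw [Complex.betaIntegral, ← intervalIntegral.integral_ofReal]
      refine intervalIntegral.integral_congr fun x hx => ?_
      rw [Set.uIcc_of_le zero_le_one] at hx
      push_cast
      rw [Complex.ofReal_cpow hx.1, Complex.ofReal_cpow (by linarith [hx.2])]
      push_cast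
      rfl
    rw [h', ← Complex.ofReal_add, Complex.Gamma_ofReal, Complex.Gamma_ofReal] at h
    exact_mod_cast h
  have hsub : ∫ t in (-1 : ℝ)..1, (1 - t ^ 2) ^ (s - 1) =
      2 * ∫ x in (0 : ℝ)..1, (1 - (2 * x - 1) ^ 2) ^ (s - 1) := by
    rw [intervalIntegral.integral_comp_mul_sub (fun t : ℝ => (1 - t ^ 2) ^ (s - 1)) two_ne_zero,
      smul_eq_mul, ← mul_assoc, mul_inv_cancel₀ two_ne_zero]
    norm_num
  have hpow : ∀ x ∈ Set.uIcc (0 : ℝ) 1, (1 - (2 * x - 1) ^ 2) ^ (s - 1) =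
      4 ^ (s - 1) * (x ^ (s - 1) * (1 - x) ^ (s - 1)) := fun x hx => by
    rw [Set.uIcc_of_le zero_le_one] at hx
    have h1 : 0 ≤ 1 - x := by linarith [hx.2]
    rw [← Real.mul_rpow hx.1 h1, ← Real.mul_rpow (by norm_num) (mul_nonneg hx.1 h1)]
    congr 1
    ring
  have h4 : (2 : ℝ) * 4 ^ (s - 1) * 2 ^ (1 - 2 * s) = 1 := by
    rw [show (4 : ℝ) = 2 ^ (2 : ℝ) by norm_num, ← Real.rpow_mul two_pos.le]
    nth_rewrite 1 [← Real.rpow_one 2]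
    rw [← Real.rpow_add two_pos, ← Real.rpow_add two_pos,
      show 1 + 2 * (s - 1) + (1 - 2 * s) = 0 by ring, Real.rpow_zero]
  rw [hsub, intervalIntegral.integral_congr hpow, intervalIntegral.integral_const_mul, hbeta]
  have hdup := Real.Gamma_mul_Gamma_add_half s
  have g1 := (Real.Gamma_pos_of_pos (show 0 < s + 1 / 2 by linarith)).ne'
  have g2 := (Real.Gamma_pos_of_pos (show 0 < 2 * s by linarith)).ne'
  rw [← two_mul s, ← mul_assoc, ← mul_div_assoc, div_eq_div_iff g2 g1]
  linear_combination 2 * 4 ^ (s - 1) * Real.Gamma s * hdup +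
    Real.Gamma s * Real.Gamma (2 * s) * Real.sqrt Real.pi * h4

/-- The weight `(1-t²)^((n-3)/2)` for which the Gegenbauer polynomials are orthogonal. At `t = ±1`
with `n = 2` its value is the junk value `0` of a negative power of `0`; this is a null set. -/
def weight (n : ℕ) (t : ℝ) : ℝ := (1 - t ^ 2) ^ (((n : ℝ) - 3) / 2)

lemma gammaConst_mul_integral_weight (hn : 2 ≤ n) :
    gammaConst n * ∫ t in (-1 : ℝ)..1, weight n t = 1 := by
  have h2 : (2 : ℝ) ≤ n := by exact_mod_cast hn
  have h := integral_one_sub_sq_rpow (s := ((n : ℝ) - 1) / 2) (by linarith)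
  rw [show ((n : ℝ) - 1) / 2 - 1 = ((n : ℝ) - 3) / 2 by ring,
    show ((n : ℝ) - 1) / 2 + 1 / 2 = (n : ℝ) / 2 by ring] at h
  simp only [weight]
  rw [h, gammaConst]
  have g1 := (Real.Gamma_pos_of_pos (show 0 < (n : ℝ) / 2 by linarith)).ne'
  have g2 := (Real.Gamma_pos_of_pos (show 0 < ((n : ℝ) - 1) / 2 by linarith)).ne'
  have g3 := (Real.sqrt_pos.mpr Real.pi_pos).ne'
  field_simp

lemma intervalIntegrable_weight (hn : 2 ≤ n) :
    IntervalIntegrable (weight n) volume (-1) 1 := by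
  -- The integral of a function that is not integrable would be `0`, but this one is `1 / γ_n`.
  refine intervalIntegral.intervalIntegrable_of_integral_ne_zero fun h => ?_
  have := gammaConst_mul_integral_weight hn
  rw [h, mul_zero] at this
  exact zero_ne_one this

lemma weight_nonneg {t : ℝ} (ht : t ∈ Set.Icc (-1 : ℝ) 1) : 0 ≤ weight n t :=
  Real.rpow_nonneg (by nlinarith [ht.1, ht.2]) _

lemma hasDerivAt_one_sub_sq_rpow_mul_eval (p : ℝ[X]) {t : ℝ} (ht : t ∈ Set.Ioo (-1 : ℝ) 1) :
    HasDerivAt (fun t => (1 - t ^ 2) ^ (((n : ℝ) - 1) / 2) * p.eval t)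
      (((1 - X ^ 2) * derivative p - ((n : ℝ[X]) - 1) * X * p).eval t * weight n t) t := by
  have h0 : 0 < 1 - t ^ 2 := by nlinarith [ht.1, ht.2]
  have hb : HasDerivAt (fun t : ℝ => 1 - t ^ 2) (-(2 * t)) t := by
    simpa using (hasDerivAt_pow 2 t).const_sub 1
  have h := (hb.rpow_const (p := ((n : ℝ) - 1) / 2) (Or.inl h0.ne')).mul (p.hasDerivAt t)
  refine h.congr_deriv ?_
  have e : (1 - t ^ 2) ^ (((n : ℝ) - 1) / 2) = (1 - t ^ 2) * weight n t := by
    rw [weight]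
    nth_rewrite 2 [← Real.rpow_one (1 - t ^ 2)]
    rw [← Real.rpow_add h0, show 1 + ((n : ℝ) - 3) / 2 = ((n : ℝ) - 1) / 2 by ring]
  rw [e, show ((n : ℝ) - 1) / 2 - 1 = ((n : ℝ) - 3) / 2 by ring, ← weight]
  simp
  ring

lemma integral_gegenbauer_succ_mul_weight (hn : 2 ≤ n) (k : ℕ) :
    ∫ t in (-1 : ℝ)..1, (gegenbauer n (k + 1)).eval t * weight n t = 0 := by
  have h2 : (2 : ℝ) ≤ n := by exact_mod_cast hn
  have hk : (0 : ℝ) ≤ k := Nat.cast_nonneg k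
  have hint : ∀ p : ℝ[X], IntervalIntegrable (fun t => p.eval t * weight n t) volume (-1) 1 :=
    fun p => (intervalIntegrable_weight hn).continuousOn_mul p.continuous.continuousOn
  set p := derivative (gegenbauer n (k + 1))
  have h := intervalIntegral.integral_eq_sub_of_hasDerivAt_of_le (by norm_num : (-1 : ℝ) ≤ 1)
    (f := fun t => (1 - t ^ 2) ^ (((n : ℝ) - 1) / 2) * p.eval t) ?_
    (fun t ht => hasDerivAt_one_sub_sq_rpow_mul_eval p ht) (hint _)
  · rw [gegenbauer_ode hn] at h
    have e : ∀ t : ℝ,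
        (-(((k : ℝ[X]) + 1) * (k + n - 1)) * gegenbauer n (k + 1)).eval t * weight n t =
          -(((k : ℝ) + 1) * (k + n - 1)) * ((gegenbauer n (k + 1)).eval t * weight n t) := by
      intro t; simp; ring
    simp only [e] at h
    rw [intervalIntegral.integral_const_mul] at h
    have hz : ((n : ℝ) - 1) / 2 ≠ 0 := by linarith
    norm_num [Real.zero_rpow hz] at h
    -- The eigenvalue `(k + 1) (k + n - 1)` is nonzero, so the integral itself vanishes.
    rcases h with h | h
    · exfalso; rcases h with h | h <;> linarith
    · exact h
  · refine ContinuousOn.mul (Continuous.continuousOn ?_) p.continuous.continuousOn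
    exact (by fun_prop : Continuous fun t : ℝ => 1 - t ^ 2).rpow_const fun t => Or.inr (by linarith)

end Orthogonality

/-! ### Values of Gegenbauer polynomials on the interval -/

open MeasureTheory

variable {n : ℕ}

lemma eval_one_gegenbauer (hn : 2 ≤ n) : ∀ k, (gegenbauer n k).eval 1 = 1
  | 0 => by simp [gegenbauer]
  | 1 => by simp [gegenbauer]
  | k + 2 => by
    have h := recurrence_denom_pos hn k
    simp only [gegenbauer, Polynomial.eval_mul, Polynomial.eval_sub, Polynomial.eval_C,
      Polynomial.eval_X, eval_one_gegenbauer hn (k + 1), eval_one_gegenbauer hn k]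
    rw [inv_mul_eq_one₀ h.ne']
    ring

lemma sphereInner_self (x : Sphere n) : sphereInner x x = I.one := by
  apply Subtype.ext
  simp [sphereInner, I.one]

lemma sphereInner_comm (x y : Sphere n) : sphereInner x y = sphereInner y x :=
  Subtype.ext (real_inner_comm _ _)

lemma exists_sphereInner_eq (hn : 2 ≤ n) (t : I) : ∃ x y : Sphere n, sphereInner x y = t := by
  let i : Fin n := ⟨0, by omega⟩
  let j : Fin n := ⟨1, by omega⟩
  have hij : i ≠ j := by simp [i, j]
  have ht : 0 ≤ 1 - (t : ℝ) ^ 2 := by nlinarith [t.2.1, t.2.2]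
  let u : EuclideanSpace ℝ (Fin n) := EuclideanSpace.single i 1
  let v : EuclideanSpace ℝ (Fin n) := EuclideanSpace.single j 1
  have huu : inner ℝ u u = (1 : ℝ) := by simp [u]
  have hvv : inner ℝ v v = (1 : ℝ) := by simp [v]
  have huv : inner ℝ u v = (0 : ℝ) := by simp [u, v, hij, EuclideanSpace.inner_single_left]
  have hvu : inner ℝ v u = (0 : ℝ) := by rw [real_inner_comm, huv]
  refine ⟨⟨u, ?_⟩, ⟨(t : ℝ) • u + Real.sqrt (1 - (t : ℝ) ^ 2) • v, ?_⟩, ?_⟩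
  · simp [u]
  · rw [mem_sphere_zero_iff_norm, norm_eq_sqrt_real_inner, Real.sqrt_eq_one]
    simp only [inner_add_left, inner_add_right, real_inner_smul_left, real_inner_smul_right,
      huu, hvv, huv, hvu]
    linear_combination Real.mul_self_sqrt ht
  · apply Subtype.ext
    simp only [sphereInner, inner_add_right, real_inner_smul_right, huu, huv]
    ring

/-- The form `P_k(⟨x,y⟩)` on two points of inner product `t` has matrix
`[[1, P_k(t)], [P_k(t), 1]]`, and its semidefiniteness forces `|P_k(t)| ≤ 1`. -/
lemma abs_eval_gegenbauer_le_one (hn : 2 ≤ n) (k : ℕ) (t : I) :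
    |(gegenbauer n k).eval (t : ℝ)| ≤ 1 := by
  obtain ⟨x, y, rfl⟩ := exists_sphereInner_eq hn t
  have h1 := eval_one_gegenbauer hn k
  have key : ∀ a : ℝ, 0 ≤ 1 + a * (gegenbauer n k).eval (sphereInner x y : ℝ) +
      (a * (gegenbauer n k).eval (sphereInner x y : ℝ) + a * a) := fun a => by
    have h := sum_mul_gegenbauer_nonneg hn k Finset.univ ![x, y] ![1, a]
    simpa [Fin.sum_univ_two, sphereInner_self, sphereInner_comm y x, I.one, h1] using h
  rw [abs_le]
  constructor <;> linarith [key 1, key (-1)]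

/-! ### The weighted mean and the energy bound -/

variable {f : C(I, ℝ)} {c : ℕ → ℝ}

lemma HasNonnegExpansion.hasSum_one (hn : 2 ≤ n) {f : I → ℝ} (hf : HasNonnegExpansion n f c) :
    HasSum c (f I.one) := by
  simpa [I.one, eval_one_gegenbauer hn] using hf.1 I.one

/-- The zeroth coefficient of a nonnegative expansion is the weighted mean of the function; the
series is integrated term by term with the dominating series `∑ |c_k|`. In particular the coefficient does
not depend on the expansion. -/
lemma weightedMean_eq_coeff_zero (hn : 2 ≤ n) (hf : HasNonnegExpansion n f c) :
    weightedMean n f = c 0 := by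
  have hc : Summable fun k => |c k| := (hf.hasSum_one hn).summable.abs
  have hw := intervalIntegrable_weight hn
  have hI : ∀ t ∈ Set.uIoc (-1 : ℝ) 1, t ∈ Set.Icc (-1 : ℝ) 1 := fun t ht => by
    rw [Set.uIoc_of_le (by norm_num)] at ht
    exact Set.Ioc_subset_Icc_self ht
  have hsum := intervalIntegral.hasSum_integral_of_dominated_convergence
    (μ := volume) (a := -1) (b := 1)
    (F := fun k t => c k * ((gegenbauer n k).eval t * weight n t))
    (f := fun t => Set.IccExtend (by norm_num : (-1 : ℝ) ≤ 1) f t * weight n t)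
    (fun k t => |c k| * weight n t)
    (fun k => ?_) (fun k => ?_) ?_ ?_ ?_
  · have h0 : ∀ k ≠ 0,
        ∫ t in (-1 : ℝ)..1, c k * ((gegenbauer n k).eval t * weight n t) = 0 := by
      intro k hk
      obtain ⟨k, rfl⟩ := Nat.exists_eq_succ_of_ne_zero hk
      rw [intervalIntegral.integral_const_mul, integral_gegenbauer_succ_mul_weight hn, mul_zero]
    have h := hsum.unique (hasSum_single 0 h0)
    simp only [gegenbauer, Polynomial.eval_one, one_mul, intervalIntegral.integral_const_mul] at h
    rw [weightedMean]
    simp only [weight] at h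
    rw [h, mul_left_comm]
    have := gammaConst_mul_integral_weight hn
    simp only [weight] at this
    rw [this, mul_one]
  · exact ((hw.continuousOn_mul (gegenbauer n k).continuous.continuousOn).const_mul
      (c k)).def'.aestronglyMeasurable
  · refine Filter.Eventually.of_forall fun t ht => ?_
    rw [norm_mul, norm_mul, Real.norm_eq_abs, Real.norm_eq_abs, Real.norm_eq_abs,
      abs_of_nonneg (weight_nonneg (hI t ht))]
    exact mul_le_mul_of_nonneg_left (mul_le_of_le_one_left (weight_nonneg (hI t ht))
      (abs_eval_gegenbauer_le_one hn k ⟨t, hI t ht⟩)) (abs_nonneg _)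
  · exact Filter.Eventually.of_forall fun t _ => hc.mul_right _
  · simp only [tsum_mul_right]
    exact hw.const_mul _
  · refine Filter.Eventually.of_forall fun t ht => ?_
    rw [Set.IccExtend_of_mem _ _ (hI t ht)]
    simpa only [mul_assoc] using (hf.1 ⟨t, hI t ht⟩).mul_right (weight n t)

/-- In the double sum of `f` over a code the terms of positive index contribute nonnegatively. -/
lemma sq_card_mul_coeff_zero_le (hn : 2 ≤ n) {f : I → ℝ} (hf : HasNonnegExpansion n f c)
    (C : Finset (Sphere n)) :
    (C.card : ℝ) ^ 2 * c 0 ≤ ∑ x ∈ C, ∑ y ∈ C, f (sphereInner x y) := by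
  have hs : HasSum (fun k => c k * ∑ x ∈ C, ∑ y ∈ C,
      (gegenbauer n k).eval (sphereInner x y : ℝ)) (∑ x ∈ C, ∑ y ∈ C, f (sphereInner x y)) := by
    simp only [Finset.mul_sum]
    exact hasSum_sum fun x _ => hasSum_sum fun y _ => hf.1 _
  have h := sum_le_hasSum {0} (fun k hk => ?_) hs
  · simpa [gegenbauer, sq, mul_comm, mul_assoc] using h
  · refine mul_nonneg (hf.2 k (Nat.one_le_iff_ne_zero.mpr (by simpa using hk))) ?_
    simpa using sum_mul_gegenbauer_nonneg hn k C id fun _ => 1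

lemma coe_ofReal_of_nonneg {r : ℝ} (hr : 0 ≤ r) : (ENNReal.ofReal r : EReal) = r := by
  rw [EReal.coe_ennreal_ofReal, max_eq_left hr]

lemma coe_sum_le_coe_sum {ι : Type*} (s : Finset ι) {g : ι → ℝ} {H : ι → ℝ≥0∞}
    (h : ∀ i ∈ s, (g i : EReal) ≤ (H i : EReal)) :
    ((∑ i ∈ s, g i : ℝ) : EReal) ≤ ((∑ i ∈ s, H i : ℝ≥0∞) : EReal) := by
  classical
  induction s using Finset.induction_on with
  | empty => simp
  | insert i s hi ih =>
    rw [Finset.sum_insert hi, Finset.sum_insert hi, EReal.coe_add, EReal.coe_ennreal_add]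
    exact add_le_add (h i (Finset.mem_insert_self i s))
      (ih fun j hj => h j (Finset.mem_insert_of_mem hj))

lemma sum_offDiag_add_card_mul {f : I → ℝ} [DecidableEq (Sphere n)] (C : Finset (Sphere n)) :
    ∑ p ∈ C.offDiag, f (sphereInner p.1 p.2) + C.card * f I.one =
      ∑ x ∈ C, ∑ y ∈ C, f (sphereInner x y) := by
  rw [← Finset.sum_product', ← Finset.diag_union_offDiag,
    Finset.sum_union (Finset.disjoint_diag_offDiag C), Finset.sum_diag, add_comm]
  simp [sphereInner_self]

/-- The linear programming (Delsarte–Yudin) bound for the energy of spherical codes. -/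
theorem le_minEnergy (hn : 2 ≤ n) {N : ℕ} (hN : 1 ≤ N) {h : I → ℝ≥0∞} {f : I → ℝ}
    (hfh : ∀ t, (f t : EReal) ≤ (h t : EReal)) (hf : HasNonnegExpansion n f c) :
    (((N : ℝ) ^ 2 * (c 0 - f I.one / N) : ℝ) : EReal) ≤ (minEnergy n N h : EReal) := by
  classical
  have hC : ∀ C : Finset (Sphere n), C.card = N →
      (((N : ℝ) ^ 2 * (c 0 - f I.one / N) : ℝ) : EReal) ≤ (energy C h : EReal) := by
    rintro C rfl
    refine le_trans ?_ (coe_sum_le_coe_sum _ (g := fun p => f (sphereInner p.1 p.2))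
      fun p _ => hfh _)
    rw [EReal.coe_le_coe_iff]
    have h₁ := sq_card_mul_coeff_zero_le hn hf C
    have h₂ := sum_offDiag_add_card_mul (f := f) C
    have h₃ : (C.card : ℝ) ≠ 0 := by positivity
    have h₄ : (C.card : ℝ) ^ 2 * (c 0 - f I.one / C.card) =
        (C.card : ℝ) ^ 2 * c 0 - C.card * f I.one := by field_simp
    convert_to _ ≤ ∑ p ∈ C.offDiag, f (sphereInner p.1 p.2)
    linarith
  rcases le_total 0 ((N : ℝ) ^ 2 * (c 0 - f I.one / N)) with h0 | h0
  · rw [← coe_ofReal_of_nonneg h0, EReal.coe_ennreal_le_coe_ennreal_iff]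
    refine le_iInf₂ fun C hcard => ?_
    rw [← EReal.coe_ennreal_le_coe_ennreal_iff, coe_ofReal_of_nonneg h0]
    exact hC C hcard
  · exact (EReal.coe_nonpos.mpr h0).trans (EReal.coe_ennreal_nonneg _)

/-! ### Quadrature sums -/

variable {N k : ℕ} {α : Fin k → I} {ρ : Fin k → ℝ} {h : I → ℝ≥0∞}

lemma coe_mul_sum_le_potentialSum (hρ : ∀ i, 0 ≤ ρ i) {f : I → ℝ}
    (hfh : ∀ i, (f (α i) : EReal) ≤ (h (α i) : EReal)) :
    (((N : ℝ) ^ 2 * ∑ i, ρ i * f (α i) : ℝ) : EReal) ≤ (potentialSum N α ρ h : EReal) := by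
  have e : (((N : ℝ≥0∞) ^ 2 : ℝ≥0∞) : EReal) = (((N : ℝ) ^ 2 : ℝ) : EReal) := by
    rw [← coe_ofReal_of_nonneg (by positivity), ENNReal.ofReal_pow (by positivity),
      ENNReal.ofReal_natCast]
  rw [potentialSum, EReal.coe_mul, EReal.coe_ennreal_mul, e]
  refine mul_le_mul_of_nonneg_left (coe_sum_le_coe_sum _ fun i _ => ?_)
    (EReal.coe_nonneg.mpr (by positivity))
  rw [EReal.coe_mul, EReal.coe_ennreal_mul, coe_ofReal_of_nonneg (hρ i)]
  exact mul_le_mul_of_nonneg_left (hfh i) (EReal.coe_nonneg.mpr (hρ i))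

lemma coe_mul_sum_eq_potentialSum (hρ : ∀ i, 0 ≤ ρ i) {f : I → ℝ}
    (hfh : ∀ i, (f (α i) : EReal) = (h (α i) : EReal)) :
    (((N : ℝ) ^ 2 * ∑ i, ρ i * f (α i) : ℝ) : EReal) = (potentialSum N α ρ h : EReal) := by
  have hf : ∀ i, 0 ≤ f (α i) := fun i => by
    rw [← EReal.coe_nonneg, hfh i]
    exact EReal.coe_ennreal_nonneg _
  have hh : ∀ i, h (α i) = ENNReal.ofReal (f (α i)) := fun i => by
    rw [← EReal.coe_ennreal_eq_coe_ennreal_iff, coe_ofReal_of_nonneg (hf i), hfh i]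
  have hs : ∀ i ∈ Finset.univ, 0 ≤ ρ i * f (α i) := fun i _ => mul_nonneg (hρ i) (hf i)
  rw [← coe_ofReal_of_nonneg (mul_nonneg (by positivity) (Finset.sum_nonneg hs)),
    potentialSum, ENNReal.ofReal_mul (by positivity), ENNReal.ofReal_sum_of_nonneg hs]
  simp [hh, ENNReal.ofReal_mul (hρ _), ENNReal.ofReal_pow]

lemma coeff_zero_sub_eq_sum (hn : 2 ≤ n) {Λ : Submodule ℝ C(I, ℝ)}
    (hexact : IsExactFor n N α ρ Λ) (hfΛ : f ∈ Λ) (hf : HasNonnegExpansion n f c) :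
    c 0 - f I.one / N = ∑ i, ρ i * f (α i) := by
  rw [← weightedMean_eq_coeff_zero hn hf, hexact f hfΛ, add_sub_cancel_left]

end SphericalCode

end

theorem theorem2p3 (n N : ℕ) (hn : 2 ≤ n) (hN : 1 ≤ N)
    (h : SphericalCode.I → ENNReal)
    (Λ : Submodule ℝ C(SphericalCode.I, ℝ))
    (k : ℕ) (α : Fin k → SphericalCode.I) (ρ : Fin k → ℝ)
    (hq : SphericalCode.IsQuadratureRule α ρ)
    (hexact : SphericalCode.IsExactFor n N α ρ Λ) :
    (∀ f ∈ Λ, (f : SphericalCode.I → ℝ) ∈ SphericalCode.admissible n h →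
      (((N : ℝ) ^ 2 * ∑ i, ρ i * f (α i) : ℝ) : EReal) ≤
        ((SphericalCode.minEnergy n N h : ENNReal) : EReal)) ∧
    SphericalCode.lpValue n N Λ h ≤ ((SphericalCode.potentialSum N α ρ h : ENNReal) : EReal) ∧
    ((∃ f ∈ Λ, (f : SphericalCode.I → ℝ) ∈ SphericalCode.admissible n h ∧
        ∀ i, ((f (α i) : ℝ) : EReal) = ((h (α i) : ENNReal) : EReal)) →
      SphericalCode.lpValue n N Λ h = ((SphericalCode.potentialSum N α ρ h : ENNReal) : EReal) ∧
      SphericalCode.potentialSum N α ρ h ≤ SphericalCode.minEnergy n N h) := by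
  have hρ : ∀ i, 0 ≤ ρ i := fun i => (hq.weight_pos i).le
  have ha : ∀ f ∈ Λ, (f : SphericalCode.I → ℝ) ∈ SphericalCode.admissible n h →
      (((N : ℝ) ^ 2 * ∑ i, ρ i * f (α i) : ℝ) : EReal) ≤
        ((SphericalCode.minEnergy n N h : ENNReal) : EReal) := by
    rintro f hfΛ ⟨hfh, c, hf⟩
    rw [← SphericalCode.coeff_zero_sub_eq_sum hn hexact hfΛ hf]
    exact SphericalCode.le_minEnergy hn hN hfh hf
  have hb : SphericalCode.lpValue n N Λ h ≤
      ((SphericalCode.potentialSum N α ρ h : ENNReal) : EReal) := by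
    refine sSup_le ?_
    rintro _ ⟨f, hfΛ, ⟨hfh, -⟩, c, hf, rfl⟩
    rw [SphericalCode.coeff_zero_sub_eq_sum hn hexact hfΛ hf]
    exact SphericalCode.coe_mul_sum_le_potentialSum hρ fun i => hfh (α i)
  refine ⟨ha, hb, ?_⟩
  rintro ⟨f, hfΛ, hfA, hfeq⟩
  have he := SphericalCode.coe_mul_sum_eq_potentialSum (N := N) hρ hfeq
  refine ⟨le_antisymm hb ?_, ?_⟩
  · obtain ⟨-, c, hf⟩ := id hfA
    rw [← he, ← SphericalCode.coeff_zero_sub_eq_sum hn hexact hfΛ hf]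
    exact le_sSup ⟨f, hfΛ, hfA, c, hf, rfl⟩
  · rw [← EReal.coe_ennreal_le_coe_ennreal_iff, ← he]
    exact ha f hfΛ hfA
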